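/- Let $G$ and $X$ be totally disconnected locally compact groups, and let $G$ act on $X$ by automorphisms, i.e. through a homomorphism $\phi\colon G\to \mathrm{Aut}(X)$ such that the map $G\times X\to X$, $(g,x)\mapsto \phi(g)(x)$, is continuous. Let $H$ be a subgroup of $G$ which is cocompact (the coset space $G/H$ is compact) or has finite covolume (there is a nonzero finite $G$-invariant regular Borel measure on $G/H$). Let $k>1$ be an integer such that the power map $P_k\colon H\to H$, $P_k(x)=x^k$, has dense image in $H$. Then for every $g\in G$ there is a compact open subgroup $U$ of $X$ with $\phi(g)(U)=U$. -/

import Mathlib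

open scoped Pointwise

/-- A subgroup `H` of a topological group `G` is cocompact if the coset space `G ⧸ H`, with the
quotient topology, is compact. -/
def IsCocompactSubgroup {G : Type*} [Group G] [TopologicalSpace G] (H : Subgroup G) : Prop :=
  CompactSpace (G ⧸ H)

/-- A subgroup `H` of a topological group `G` has finite covolume if the coset space `G ⧸ H`
carries a nonzero finite regular Borel measure which is invariant under left translations
by `G`. -/
def HasFiniteCovolume {G : Type*} [Group G] [TopologicalSpace G] (H : Subgroup G) : Prop :=
  ∃ μ : @MeasureTheory.Measure (G ⧸ H) (borel (G ⧸ H)),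
    μ ≠ 0 ∧
    @MeasureTheory.IsFiniteMeasure (G ⧸ H) (borel (G ⧸ H)) μ ∧
    @MeasureTheory.Measure.Regular (G ⧸ H) (borel (G ⧸ H)) _ μ ∧
    ∀ (g : G) (A : Set (G ⧸ H)), @MeasurableSet (G ⧸ H) (borel (G ⧸ H)) A → μ (g • A) = μ A

/-- The power map `x ↦ x ^ k` is dense in the topological group `H`: its image is dense. -/
def PowerMapDense (k : ℕ) (H : Type*) [Group H] [TopologicalSpace H] : Prop :=
  DenseRange (fun x : H => x ^ k)

/-!
For a compact open subgroup `U` of `X`, let `d_n(g)` be the index of `U ∩ gⁿ U` in `U`. The proof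
studies the exponential growth rate `s(g)` of `d_n(g)`, the scale of `g`, which does not depend on
`U`. It satisfies `s(gᵏ) = s(g)ᵏ` and is invariant under conjugation. Three further facts are needed.

* *Integrality* (`TidyAbove.exists_hasScale_and_relIndex_eq`). Every automorphism `g` admits a `U`
  that is tidy above: `U = P M`, where `P` and `M` consist of the elements whose backward,
  respectively forward, orbit stays in `U` (`exists_tidyAbove_le`). Put `t = [g⁻¹ M : M]` and let
  `c_n` be the number of cosets of `M` in `g⁻¹ M` that meet `gⁿ U`. Then `c_n d_{n+1} = t d_n`. Since
  `gⁿ U M = gⁿ P M` increases with `n`, the `c_n` increase and are bounded by `t`, so they are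
  eventually constant, and `d_n` is eventually geometric. Its ratio `t / c` is an integer because
  all `d_n` are.
* *Scale one* (`exists_compact_open_smul_eq`). If `s(g) = s(g⁻¹) = 1` then `c = t`, which means
  `g⁻ᵐ M ⊆ gᴺ P M` for a fixed `N` and all `m`, and symmetrically for `g⁻¹`. It follows that
  `(⋃ gᵐ P) M` is a compact open subgroup, and it is invariant under `g`.
* *Local constancy* (`exists_open_subgroup_hasScale_doubleCoset_iff`). Let `V` be a compact open
  subgroup of `G` that stabilizes `U` and is tidy above for conjugation by `g`. Then
  `V gᵃ V gᵇ V = V gᵃ⁺ᵇ V`, so `x ∈ V gᵃ V` gives `xⁿ ∈ V gᵃⁿ V` and `d_n(x) = d_n(gᵃ)`.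

If the `k`-th powers are dense in `H`, local constancy makes the scale of every element of `H` the
`k`-th power of the scale of another element of `H`. As scales are positive integers, descent shows
that they are all `1`. For `g ∈ G`, compactness or Poincaré recurrence in `G ⧸ H` gives `n ≥ 1` with
`V gⁿ V` meeting a conjugate of `H`, so `s(g)ⁿ = 1`. Thus `s(g) = s(g⁻¹) = 1`.
-/

open Topology

/-! ### Relative indices -/

section RelIndex

variable {X : Type*} [Group X] {A B K : Subgroup X}

theorem relIndex_eq_of_subset_mul (hAB : A ≤ B) (h : (B : Set X) ⊆ (A : Set X) * (K : Set X)) :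
    K.relIndex A = K.relIndex B := by
  refine Nat.card_congr (Equiv.ofBijective (Subgroup.quotientSubgroupOfEmbeddingOfLE K hAB)
    ⟨(Subgroup.quotientSubgroupOfEmbeddingOfLE K hAB).injective, fun q => ?_⟩)
  obtain ⟨⟨b, hb⟩, rfl⟩ := QuotientGroup.mk_surjective q
  obtain ⟨a, ha, x, hx, rfl⟩ := h hb
  refine ⟨QuotientGroup.mk ⟨a, ha⟩, ?_⟩
  rw [Subgroup.quotientSubgroupOfEmbeddingOfLE_apply_mk, QuotientGroup.eq]
  simpa [Subgroup.mem_subgroupOf] using hx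

theorem subset_mul_of_relIndex_eq (hAB : A ≤ B) (h : K.relIndex A = K.relIndex B)
    (h0 : K.relIndex B ≠ 0) : (B : Set X) ⊆ (A : Set X) * (K : Set X) := by
  intro b hb
  have : Finite (B ⧸ K.subgroupOf B) := Nat.finite_of_card_ne_zero h0
  have hsurj := ((Nat.bijective_iff_injective_and_card
    (Subgroup.quotientSubgroupOfEmbeddingOfLE K hAB)).2
      ⟨(Subgroup.quotientSubgroupOfEmbeddingOfLE K hAB).injective, h⟩).2
  obtain ⟨q, hq⟩ := hsurj (QuotientGroup.mk ⟨b, hb⟩)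
  obtain ⟨⟨a, ha⟩, rfl⟩ := QuotientGroup.mk_surjective q
  rw [Subgroup.quotientSubgroupOfEmbeddingOfLE_apply_mk, QuotientGroup.eq] at hq
  refine ⟨a, ha, a⁻¹ * b, ?_, by simp⟩
  simpa [Subgroup.mem_subgroupOf] using hq

theorem relIndex_ne_zero_of_isOpen_of_isCompact [TopologicalSpace X] [IsTopologicalGroup X]
    (hK : IsOpen (K : Set X)) (hA : IsCompact (A : Set X)) : K.relIndex A ≠ 0 := by
  have : CompactSpace A := isCompact_iff_compactSpace.1 hA
  have hopen : IsOpen (K.subgroupOf A : Set A) := hK.preimage continuous_subtype_val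
  have : Finite (A ⧸ K.subgroupOf A) := Subgroup.quotient_finite_of_isOpen _ hopen
  exact Subgroup.index_ne_zero_of_finite

end RelIndex

/-! ### Integer sequences with eventually geometric growth -/

theorem le_of_forall_pow_le_mul_pow {a b C : ℕ} (h : ∀ n, a ^ n ≤ C * b ^ n) : a ≤ b := by
  by_contra! hab
  rcases Nat.eq_zero_or_pos b with rfl | hb
  · have := h 1
    simp at this
    omega
  have hb' : (0 : ℝ) < b := by exact_mod_cast hb
  obtain ⟨n, hn⟩ := pow_unbounded_of_one_lt (C : ℝ) (y := (a : ℝ) / b)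
    ((one_lt_div hb').2 (by exact_mod_cast hab))
  rw [div_pow, lt_div_iff₀ (by positivity)] at hn
  exact absurd (h n) (not_le.2 (by exact_mod_cast hn))

theorem dvd_of_forall_pow_dvd_pow_mul {c t d : ℕ} (hc : c ≠ 0) (hd : d ≠ 0)
    (h : ∀ n, c ^ n ∣ t ^ n * d) : c ∣ t := by
  obtain ⟨c', t', hco, hc', ht'⟩ := Nat.exists_coprime c t
  set q := Nat.gcd c t
  have hq : q ≠ 0 := Nat.gcd_ne_zero_left hc
  have key : ∀ n, c' ^ n ∣ d := fun n => by
    have h1 := h n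
    rw [hc', ht', mul_pow, mul_pow, mul_right_comm] at h1
    exact ((hco.pow n n).dvd_of_dvd_mul_left (Nat.dvd_of_mul_dvd_mul_right
      (Nat.pos_of_ne_zero (pow_ne_zero n hq)) h1))
  have hc1 : c' ≤ 1 := le_of_forall_pow_le_mul_pow (C := d) fun n => by
    simpa using Nat.le_of_dvd (Nat.pos_of_ne_zero hd) (key n)
  have : c' ≠ 0 := by rintro rfl; simp at hc'; exact hc hc'
  obtain rfl : c' = 1 := by omega
  rw [one_mul] at hc'
  exact hc' ▸ Nat.gcd_dvd_right c t

/-- A positive integer sequence whose successive ratios have the form `t / c n`, with `c` monotone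
and bounded, is eventually geometric. The limiting ratio is an integer, since `(t / c) ^ n * d`
remains an integer for all `n`. -/
theorem exists_eventually_geometric {c d : ℕ → ℕ} {t : ℕ} (hd : ∀ n, d n ≠ 0) (hc : Monotone c)
    (hc0 : c 0 ≠ 0) (hct : ∀ n, c n ≤ t) (hrec : ∀ n, c n * d (n + 1) = t * d n) :
    ∃ N s, t = c N * s ∧ ∀ m, d (N + m) = s ^ m * d N := by
  obtain ⟨N, hN⟩ : ∃ N, ∀ n, N ≤ n → c n = c N := by
    have hfin : (Set.range c).Finite := (Set.finite_Iic t).subset (by rintro _ ⟨n, rfl⟩; exact hct n)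
    obtain ⟨_, ⟨N, rfl⟩, hN⟩ := hfin.exists_maximal (Set.range_nonempty c)
    exact ⟨N, fun n hn => le_antisymm (hN ⟨n, rfl⟩ (hc hn)) (hc hn)⟩
  have hcN : c N ≠ 0 := by have := hc (Nat.zero_le N); omega
  have hpow : ∀ m, c N ^ m * d (N + m) = t ^ m * d N := by
    intro m
    induction m with
    | zero => simp
    | succ m ih =>
      have := hrec (N + m)
      rw [hN (N + m) (by omega)] at this
      rw [pow_succ, mul_assoc, ← add_assoc, this, mul_left_comm, ih, pow_succ]
      ring
  obtain ⟨s, hs⟩ := dvd_of_forall_pow_dvd_pow_mul hcN (hd N) fun n => ⟨_, (hpow n).symm⟩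
  refine ⟨N, s, hs, fun m => ?_⟩
  have := hpow m
  rw [hs, mul_pow, mul_assoc] at this
  exact Nat.eq_of_mul_eq_mul_left (Nat.pos_of_ne_zero (pow_ne_zero m hcN)) this

theorem exists_comparison_of_eventually_geometric {d : ℕ → ℕ} {N s : ℕ} (hd : ∀ n, d n ≠ 0)
    (h : ∀ m, d (N + m) = s ^ m * d N) : ∃ C, ∀ n, s ^ n ≤ C * d n ∧ d n ≤ C * s ^ n := by
  have hs : s ≠ 0 := by rintro rfl; exact hd (N + 1) (by simp [h 1])
  refine ⟨s ^ N + d N + ∑ i ∈ Finset.range N, d i, fun n => ?_⟩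
  have hdn := Nat.one_le_iff_ne_zero.2 (hd n)
  have hsn : 1 ≤ s ^ n := Nat.one_le_iff_ne_zero.2 (pow_ne_zero n hs)
  rcases lt_or_ge n N with hn | hn
  · have h1 : d n ≤ ∑ i ∈ Finset.range N, d i :=
      Finset.single_le_sum (f := d) (fun _ _ => Nat.zero_le _) (Finset.mem_range.2 hn)
    have h2 : s ^ n ≤ s ^ N := Nat.pow_le_pow_right (Nat.pos_of_ne_zero hs) hn.le
    constructor <;> nlinarith
  · obtain ⟨m, rfl⟩ := Nat.exists_eq_add_of_le hn
    have hdN := Nat.one_le_iff_ne_zero.2 (hd N)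
    have hsN : 1 ≤ s ^ N := Nat.one_le_iff_ne_zero.2 (pow_ne_zero N hs)
    have hsm : 1 ≤ s ^ m := Nat.one_le_iff_ne_zero.2 (pow_ne_zero m hs)
    rw [h m, pow_add]
    constructor
    · calc s ^ N * s ^ m ≤ s ^ N * (s ^ m * d N) :=
            Nat.mul_le_mul_left _ (Nat.le_mul_of_pos_right _ hdN)
        _ ≤ _ := Nat.mul_le_mul_right _ (by omega)
    · calc s ^ m * d N ≤ d N * (s ^ N * s ^ m) := by
            rw [mul_comm]; exact Nat.mul_le_mul_left _ (Nat.le_mul_of_pos_left _ hsN)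
        _ ≤ _ := Nat.mul_le_mul_right _ (by omega)

/-! ### Totally disconnected locally compact groups -/

/-- Van Dantzig's theorem. Inside a compact open neighbourhood `W` of `1`, the elements `x` with
`W x = W` form an open subgroup. -/
theorem exists_compact_open_subgroup_subset {X : Type*} [Group X] [TopologicalSpace X]
    [IsTopologicalGroup X] [LocallyCompactSpace X] [TotallyDisconnectedSpace X]
    {S : Set X} (hS : S ∈ 𝓝 (1 : X)) :
    ∃ U : Subgroup X, IsCompact (U : Set X) ∧ IsOpen (U : Set X) ∧ (U : Set X) ⊆ S := by
  obtain ⟨K, hK, hKS, hKc⟩ := local_compact_nhds hS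
  obtain ⟨W, hW, h1W, hWK⟩ := loc_compact_Haus_tot_disc_of_zero_dim.mem_nhds_iff.1 hK
  have hWc : IsCompact W := hKc.of_isClosed_subset hW.1 hWK
  let U : Subgroup X :=
    { carrier := {x | ∀ w, w * x ∈ W ↔ w ∈ W}
      one_mem' := fun w => by simp
      mul_mem' := fun {a b} ha hb w => by rw [← mul_assoc, hb, ha]
      inv_mem' := fun {a} ha w => by rw [← ha (w * a⁻¹)]; simp }
  have hUW : (U : Set X) ⊆ W := fun x hx => by simpa [h1W] using hx 1
  have hUo : IsOpen (U : Set X) := by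
    obtain ⟨V, hV, hWV⟩ := compact_open_separated_mul_right hWc hW.2 subset_rfl
    refine U.isOpen_of_mem_nhds (g := 1) ?_
    filter_upwards [hV, inv_mem_nhds_one X hV] with x hx hx' w
    refine ⟨fun h => ?_, fun h => hWV ⟨w, h, x, hx, rfl⟩⟩
    simpa using hWV ⟨w * x, h, x⁻¹, hx', rfl⟩
  exact ⟨U, hWc.of_isClosed_subset (U.isClosed_of_isOpen hUo) hUW, hUo,
    hUW.trans (hWK.trans hKS)⟩

/-! ### Subgroups cut out by orbits -/

section Window

variable {Γ X : Type*} [Group Γ] [Group X] [MulDistribMulAction Γ X]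

/-- The subgroup `⋂ j ∈ S, g⁻ʲ U` of those elements whose translates by `g ^ j`, for the times
`j ∈ S`, all lie in `U`. -/
def window (g : Γ) (U : Subgroup X) (S : Set ℤ) : Subgroup X where
  carrier := {x | ∀ j ∈ S, g ^ j • x ∈ U}
  one_mem' := fun j _ => by simp
  mul_mem' := fun ha hb j hj => by rw [smul_mul']; exact U.mul_mem (ha j hj) (hb j hj)
  inv_mem' := fun ha j hj => by rw [smul_inv']; exact U.inv_mem (ha j hj)

variable {g : Γ} {U : Subgroup X} {S T : Set ℤ} {x : X}

theorem mem_window : x ∈ window g U S ↔ ∀ j ∈ S, g ^ j • x ∈ U := Iff.rfl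

theorem mem_zpow_smul_iff {n : ℤ} : x ∈ g ^ n • U ↔ g ^ (-n) • x ∈ U := by
  rw [Subgroup.mem_pointwise_smul_iff_inv_smul_mem, zpow_neg]

theorem window_anti (h : S ⊆ T) : window g U T ≤ window g U S := fun _ hx j hj => hx j (h hj)

theorem window_le (h : 0 ∈ S) : window g U S ≤ U := fun x hx => by simpa using hx 0 h

theorem zpow_smul_mem_window {n : ℤ} : g ^ n • x ∈ window g U S ↔ ∀ j ∈ S, g ^ (j + n) • x ∈ U := by
  simp only [mem_window, smul_smul, zpow_add]

theorem window_inv : window g⁻¹ U S = window g U (-S) := by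
  ext x
  refine ⟨fun h j hj => ?_, fun h j hj => ?_⟩
  · simpa using h (-j) hj
  · simpa using h (-j) (by simpa using hj)

variable [TopologicalSpace X] [ContinuousConstSMul Γ X]

theorem isClosed_window (hU : IsClosed (U : Set X)) : IsClosed (window g U S : Set X) := by
  have : (window g U S : Set X) = ⋂ j ∈ S, (fun x => g ^ j • x) ⁻¹' U := by
    ext x; simp [mem_window]
  rw [this]
  exact isClosed_biInter fun j _ => hU.preimage (continuous_const_smul _)

theorem isOpen_window (hU : IsOpen (U : Set X)) (hS : S.Finite) :
    IsOpen (window g U S : Set X) := by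
  have : (window g U S : Set X) = ⋂ j ∈ S, (fun x => g ^ j • x) ⁻¹' U := by
    ext x; simp [mem_window]
  rw [this]
  exact hS.isOpen_biInter fun j _ => hU.preimage (continuous_const_smul _)

theorem isCompact_window (hU : IsCompact (U : Set X)) (hU' : IsClosed (U : Set X)) (h : 0 ∈ S) :
    IsCompact (window g U S : Set X) :=
  hU.of_isClosed_subset (isClosed_window hU') (window_le h)

end Window

/-! ### Tidiness above -/

section Tidy

variable {Γ X : Type*} [Group Γ] [Group X] [MulDistribMulAction Γ X]

/-- The elements of `U` whose whole forward orbit under `g` stays in `U`. -/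
abbrev forwardPart (g : Γ) (U : Subgroup X) : Subgroup X := window g U (Set.Ici 0)

/-- The elements of `U` whose whole backward orbit under `g` stays in `U`. -/
abbrev backwardPart (g : Γ) (U : Subgroup X) : Subgroup X := window g U (Set.Iic 0)

/-- `U` is tidy above for `g` if each of its elements is a product of an element whose backward
orbit stays in `U` and an element whose forward orbit stays in `U`. -/
def TidyAbove (g : Γ) (U : Subgroup X) : Prop :=
  (U : Set X) ⊆ (backwardPart g U : Set X) * (forwardPart g U : Set X)

theorem backwardPart_inv (g : Γ) (U : Subgroup X) : backwardPart g⁻¹ U = forwardPart g U := by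
  unfold forwardPart backwardPart
  rw [window_inv]; congr 1; ext; simp

theorem forwardPart_inv (g : Γ) (U : Subgroup X) : forwardPart g⁻¹ U = backwardPart g U := by
  unfold forwardPart backwardPart
  rw [window_inv]; congr 1; ext; simp

theorem forwardPart_le (g : Γ) (U : Subgroup X) : forwardPart g U ≤ U := window_le (by simp)

theorem backwardPart_le (g : Γ) (U : Subgroup X) : backwardPart g U ≤ U := window_le (by simp)

variable {g : Γ} {U : Subgroup X}

theorem TidyAbove.subset_forward_mul_backward (h : TidyAbove g U) :
    (U : Set X) ⊆ (forwardPart g U : Set X) * (backwardPart g U : Set X) := by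
  intro x hx
  obtain ⟨p, hp, m, hm, hpm⟩ := h (U.inv_mem hx)
  refine ⟨m⁻¹, inv_mem hm, p⁻¹, inv_mem hp, ?_⟩
  change p * m = x⁻¹ at hpm
  change m⁻¹ * p⁻¹ = x
  rw [← mul_inv_rev, hpm, inv_inv]

theorem TidyAbove.inv (h : TidyAbove g U) : TidyAbove g⁻¹ U := by
  unfold TidyAbove
  rw [backwardPart_inv, forwardPart_inv]
  exact h.subset_forward_mul_backward

/-- The forward orbit of `forwardPart g U` stays inside it. -/
theorem zpow_smul_mem_forwardPart {x : X} (hx : x ∈ forwardPart g U) {n : ℤ} (hn : 0 ≤ n) :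
    g ^ n • x ∈ forwardPart g U :=
  zpow_smul_mem_window.2 fun j hj => hx _ (by simp only [Set.mem_Ici] at *; omega)

theorem zpow_smul_mem_backwardPart {x : X} (hx : x ∈ backwardPart g U) {n : ℤ} (hn : n ≤ 0) :
    g ^ n • x ∈ backwardPart g U :=
  zpow_smul_mem_window.2 fun j hj => hx _ (by simp only [Set.mem_Iic] at *; omega)

theorem mem_mul_iInter_of_forall_mem_mul [TopologicalSpace X] [IsTopologicalGroup X]
    {P : Set X} {D : ℕ → Set X} (hP : IsCompact P) (hPc : IsClosed P) (hD : ∀ n, IsClosed (D n))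
    (hanti : Antitone D) {x : X} (h : ∀ n, x ∈ P * D n) : x ∈ P * ⋂ n, D n := by
  have hcl : ∀ n, IsClosed (P ∩ (fun p => p⁻¹ * x) ⁻¹' D n) := fun n =>
    hPc.inter ((hD n).preimage (by fun_prop))
  obtain ⟨p, hp⟩ := IsCompact.nonempty_iInter_of_sequence_nonempty_isCompact_isClosed
    (fun n => P ∩ (fun p => p⁻¹ * x) ⁻¹' D n)
    (fun n => Set.inter_subset_inter_right _ (Set.preimage_mono (hanti (Nat.le_succ n))))
    (fun n => by
      obtain ⟨p, hp, y, hy, rfl⟩ := h n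
      exact ⟨p, hp, by simpa using hy⟩)
    (hP.inter_right ((hD 0).preimage (by fun_prop))) hcl
  rw [Set.mem_iInter] at hp
  exact ⟨p, (hp 0).1, p⁻¹ * x, Set.mem_iInter.2 fun n => (hp n).2, by simp⟩

variable [TopologicalSpace X] [IsTopologicalGroup X] [ContinuousConstSMul Γ X]

/-- Every compact open subgroup `V` contains one that is tidy above: by compactness, the elements
whose backward orbit stays in `V` for a sufficiently long finite time can, after correction by
`backwardPart g V`, be kept in `V` one step further into the future. -/
theorem exists_tidyAbove_le (g : Γ) {V : Subgroup X} (hVc : IsCompact (V : Set X))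
    (hVo : IsOpen (V : Set X)) :
    ∃ U ≤ V, IsCompact (U : Set X) ∧ IsOpen (U : Set X) ∧ TidyAbove g U := by
  have hVcl : IsClosed (V : Set X) := V.isClosed_of_isOpen hVo
  set P := backwardPart g V
  -- For large `N`, the translate by `g` of the window `[-N, 0]` lies in `g P V`.
  obtain ⟨N, hN⟩ : ∃ N : ℕ, ∀ x ∈ window g V (Set.Icc (-(N : ℤ)) 0),
      ∃ p ∈ P, g • (p⁻¹ * x) ∈ V := by
    have hopen : IsOpen ((P : Set X) * (fun x : X => g • x) ⁻¹' (V : Set X)) :=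
      (hVo.preimage (continuous_const_smul g)).mul_left
    have hInter : (⋂ N : ℕ, (window g V (Set.Icc (-(N : ℤ)) 0) : Set X)) ⊆
        (P : Set X) * (fun x : X => g • x) ⁻¹' (V : Set X) := by
      intro x hx
      refine ⟨x, fun j hj => ?_, 1, by simp, by simp⟩
      rw [Set.mem_iInter] at hx
      exact hx j.natAbs j ⟨by omega, hj⟩
    obtain ⟨N, hN⟩ := exists_subset_nhds_of_isCompact'
      (V := fun N : ℕ => (window g V (Set.Icc (-(N : ℤ)) 0) : Set X))
      (directed_of_isDirected_le fun a b hab =>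
        window_anti (Set.Icc_subset_Icc_left (by simpa using hab)))
      (fun i => isCompact_window hVc hVcl (by simp))
      (fun i => isClosed_window hVcl)
      (fun x hx => hopen.mem_nhds (hInter hx))
    refine ⟨N, fun x hx => ?_⟩
    obtain ⟨p, hp, v, hv, rfl⟩ := hN hx
    exact ⟨p, hp, by simpa using hv⟩
  have hstep : ∀ m : ℕ, ∀ x ∈ window g V (Set.Icc (-(N : ℤ)) m),
      ∃ p ∈ P, p⁻¹ * x ∈ window g V (Set.Icc (-(N : ℤ)) (m + 1)) := by
    intro m x hx
    obtain ⟨p, hp, hpx⟩ := hN (g ^ (m : ℤ) • x) (zpow_smul_mem_window.2 fun j hj =>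
      hx _ (by simp only [Set.mem_Icc] at *; omega))
    have hp' : g ^ (-(m : ℤ)) • p ∈ P := zpow_smul_mem_backwardPart hp (by omega)
    refine ⟨g ^ (-(m : ℤ)) • p, hp', fun j hj => ?_⟩
    rcases eq_or_lt_of_le hj.2 with rfl | hlt
    · rw [add_comm (m : ℤ) 1, zpow_add, zpow_one, mul_smul, smul_mul' (g ^ (m : ℤ)), smul_inv',
        smul_smul (g ^ (m : ℤ)), ← zpow_add]
      simpa using hpx
    · rw [smul_mul', smul_inv', smul_smul, ← zpow_add]
      exact V.mul_mem (V.inv_mem (hp _ (by simp only [Set.mem_Iic]; omega)))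
        (hx j ⟨hj.1, by omega⟩)
  have hiter : ∀ x ∈ window g V (Set.Icc (-(N : ℤ)) 0), ∀ m : ℕ,
      x ∈ (P : Set X) * (window g V (Set.Icc (-(N : ℤ)) m) : Set X) := by
    intro x hx m
    induction m with
    | zero => exact ⟨1, P.one_mem, x, by simpa using hx, by simp⟩
    | succ m ih =>
      obtain ⟨p, hp, y, hy, rfl⟩ := ih
      obtain ⟨q, hq, hqy⟩ := hstep m y hy
      exact ⟨p * q, P.mul_mem hp hq, q⁻¹ * y, by simpa using hqy, by simp [mul_assoc]⟩
  refine ⟨window g V (Set.Icc (-(N : ℤ)) 0), window_le (by simp),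
    isCompact_window hVc hVcl (by simp), isOpen_window hVo (Set.finite_Icc _ _), fun x hx => ?_⟩
  obtain ⟨p, hp, y, hy, rfl⟩ := mem_mul_iInter_of_forall_mem_mul
    (isCompact_window hVc hVcl (by simp)) (isClosed_window hVcl)
    (fun m => isClosed_window hVcl)
    (fun a b hab => window_anti (Set.Icc_subset_Icc_right (by simpa using hab))) (hiter x hx)
  rw [Set.mem_iInter] at hy
  refine ⟨p, fun j hj => zpow_smul_mem_window.2 fun i hi => hp _ ?_, y,
    fun j hj => zpow_smul_mem_window.2 fun i hi => hy (i + j).natAbs _ ?_, rfl⟩ <;>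
  · simp only [Set.mem_Iic, Set.mem_Ici, Set.mem_Icc] at *
    omega

end Tidy

/-! ### The scale of an automorphism -/

section Scale

variable {Γ X : Type*} [Group Γ] [Group X] [MulDistribMulAction Γ X] [TopologicalSpace X]

variable (X) in
/-- The integer `s` is the scale of `g` acting on `X`: for every compact open subgroup `U`, the
index of `U ∩ gⁿ U` in `U` equals `s ^ n` up to a multiplicative constant depending on `U`.
This is the asymptotic form of Willis's scale function, which does not refer to minimizing
subgroups; with the convention that minimizes the index of `U ∩ g U` in `g U`, it is the scale of
`g⁻¹`. -/
def HasScale (g : Γ) (s : ℕ) : Prop :=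
  ∀ U : Subgroup X, IsCompact (U : Set X) → IsOpen (U : Set X) →
    ∃ C, ∀ n : ℕ, s ^ n ≤ C * (g ^ n • U).relIndex U ∧ (g ^ n • U).relIndex U ≤ C * s ^ n

theorem isOpen_smul_subgroup [ContinuousConstSMul Γ X] (g : Γ) {U : Subgroup X}
    (hU : IsOpen (U : Set X)) : IsOpen ((g • U : Subgroup X) : Set X) := by
  rw [Subgroup.coe_pointwise_smul]; exact hU.smul g

theorem isCompact_smul_subgroup [ContinuousConstSMul Γ X] (g : Γ) {U : Subgroup X}
    (hU : IsCompact (U : Set X)) : IsCompact ((g • U : Subgroup X) : Set X) := by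
  rw [Subgroup.coe_pointwise_smul]; exact hU.smul g

theorem HasScale.pow {g : Γ} {s : ℕ} (h : HasScale X g s) (k : ℕ) :
    HasScale X (g ^ k) (s ^ k) := by
  intro U hUc hUo
  obtain ⟨C, hC⟩ := h U hUc hUo
  exact ⟨C, fun n => by simpa only [← pow_mul] using hC (k * n)⟩

theorem HasScale.conj [ContinuousConstSMul Γ X] {g : Γ} {s : ℕ} (h : HasScale X g s) (y : Γ) :
    HasScale X (y * g * y⁻¹) s := by
  intro U hUc hUo
  obtain ⟨C, hC⟩ := h (y⁻¹ • U) (isCompact_smul_subgroup _ hUc) (isOpen_smul_subgroup _ hUo)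
  refine ⟨C, fun n => ?_⟩
  have : ((y * g * y⁻¹) ^ n • U).relIndex U = (g ^ n • y⁻¹ • U).relIndex (y⁻¹ • U) := by
    rw [← Subgroup.relIndex_pointwise_smul y⁻¹ _ U, conj_pow, mul_smul, mul_smul, inv_smul_smul]
  rw [this]
  exact hC n

theorem HasScale.le {g : Γ} {s s' : ℕ} {U : Subgroup X} (hUc : IsCompact (U : Set X))
    (hUo : IsOpen (U : Set X)) (h : HasScale X g s) (h' : HasScale X g s') : s ≤ s' := by
  obtain ⟨C, hC⟩ := h U hUc hUo
  obtain ⟨C', hC'⟩ := h' U hUc hUo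
  exact le_of_forall_pow_le_mul_pow (C := C * C') fun n => by
    rw [mul_assoc]
    exact (hC n).1.trans (Nat.mul_le_mul_left _ (hC' n).2)

theorem HasScale.eq {g : Γ} {s s' : ℕ} {U : Subgroup X} (hUc : IsCompact (U : Set X))
    (hUo : IsOpen (U : Set X)) (h : HasScale X g s) (h' : HasScale X g s') : s = s' :=
  le_antisymm (h.le hUc hUo h') (h'.le hUc hUo h)

theorem HasScale.unique [IsTopologicalGroup X] [LocallyCompactSpace X] [TotallyDisconnectedSpace X]
    {g : Γ} {s s' : ℕ} (h : HasScale X g s) (h' : HasScale X g s') : s = s' := by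
  obtain ⟨V, hVc, hVo, -⟩ := exists_compact_open_subgroup_subset (X := X) Filter.univ_mem
  exact h.eq hVc hVo h'

variable [IsTopologicalGroup X] [ContinuousConstSMul Γ X]

theorem relIndex_smul_self_ne_zero (g : Γ) {U : Subgroup X} (hUc : IsCompact (U : Set X))
    (hUo : IsOpen (U : Set X)) : (g • U).relIndex U ≠ 0 :=
  relIndex_ne_zero_of_isOpen_of_isCompact (isOpen_smul_subgroup g hUo) hUc

theorem relIndex_smul_self_le_mul_of_le (g : Γ) {W U : Subgroup X} (h : W ≤ U)
    (hUc : IsCompact (U : Set X)) (hWo : IsOpen (W : Set X)) :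
    (g • U).relIndex U ≤ W.relIndex U * (g • W).relIndex W := by
  have hgW := isOpen_smul_subgroup g hWo
  have hinf : IsOpen ((g • W ⊓ W : Subgroup X) : Set X) := hgW.inter hWo
  calc (g • U).relIndex U ≤ (g • W).relIndex U := Subgroup.relIndex_le_of_le_left
        (Subgroup.pointwise_smul_le_pointwise_smul_iff.2 h)
        (relIndex_ne_zero_of_isOpen_of_isCompact hgW hUc)
    _ ≤ (g • W ⊓ W).relIndex U := Subgroup.relIndex_le_of_le_left inf_le_left
        (relIndex_ne_zero_of_isOpen_of_isCompact hinf hUc)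
    _ = W.relIndex U * (g • W).relIndex W := by
      rw [← Subgroup.relIndex_inf_mul_relIndex, inf_of_le_left h, mul_comm]

theorem relIndex_smul_self_le_mul_of_ge (g : Γ) {W U : Subgroup X} (h : W ≤ U)
    (hUc : IsCompact (U : Set X)) (hWo : IsOpen (W : Set X)) :
    (g • W).relIndex W ≤ W.relIndex U * (g • U).relIndex U := by
  have hUo := Subgroup.isOpen_mono h hWo
  calc (g • W).relIndex W = (g • W ⊓ g • U).relIndex W := by
        rw [inf_of_le_left (Subgroup.pointwise_smul_le_pointwise_smul_iff.2 h)]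
    _ = (g • W).relIndex (g • U ⊓ W) * (g • U).relIndex W :=
        (Subgroup.relIndex_inf_mul_relIndex ..).symm
    _ ≤ (g • W).relIndex (g • U) * (g • U).relIndex U := Nat.mul_le_mul
        (Subgroup.relIndex_le_of_le_right inf_le_left (relIndex_ne_zero_of_isOpen_of_isCompact
          (isOpen_smul_subgroup g hWo) (isCompact_smul_subgroup g hUc)))
        (Subgroup.relIndex_le_of_le_right h (relIndex_smul_self_ne_zero g hUc hUo))
    _ = _ := by rw [Subgroup.relIndex_pointwise_smul]

/-- The indices for two compact open subgroups differ by a bounded factor, so the scale can be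
computed with any one of them. -/
theorem hasScale_of_compact_open {g : Γ} {s : ℕ} {U : Subgroup X} (hUc : IsCompact (U : Set X))
    (hUo : IsOpen (U : Set X))
    (h : ∃ C, ∀ n : ℕ, s ^ n ≤ C * (g ^ n • U).relIndex U ∧ (g ^ n • U).relIndex U ≤ C * s ^ n) :
    HasScale X g s := by
  obtain ⟨C, hC⟩ := h
  intro V hVc hVo
  have hWo : IsOpen ((U ⊓ V : Subgroup X) : Set X) := hUo.inter hVo
  set A := (U ⊓ V).relIndex U
  set B := (U ⊓ V).relIndex V
  refine ⟨C * (A * B), fun n => ?_⟩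
  have h1 := relIndex_smul_self_le_mul_of_le (g ^ n) inf_le_left hUc hWo (W := U ⊓ V)
  have h2 := relIndex_smul_self_le_mul_of_ge (g ^ n) inf_le_left hUc hWo (W := U ⊓ V)
  have h3 := relIndex_smul_self_le_mul_of_le (g ^ n) inf_le_right hVc hWo (W := U ⊓ V)
  have h4 := relIndex_smul_self_le_mul_of_ge (g ^ n) inf_le_right hVc hWo (W := U ⊓ V)
  constructor
  · calc s ^ n ≤ C * (g ^ n • U).relIndex U := (hC n).1
      _ ≤ C * (A * (B * (g ^ n • V).relIndex V)) :=
        Nat.mul_le_mul_left _ (h1.trans (Nat.mul_le_mul_left _ h4))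
      _ = _ := by ring
  · calc (g ^ n • V).relIndex V ≤ B * (A * (C * s ^ n)) :=
        h3.trans (Nat.mul_le_mul_left _ (h2.trans (Nat.mul_le_mul_left _ (hC n).2)))
      _ = _ := by ring

end Scale

/-! ### Growth of indices along a subgroup that is tidy above -/

section Growth

variable {Γ X : Type*} [Group Γ] [Group X] [MulDistribMulAction Γ X] {g : Γ} {U : Subgroup X}

theorem backwardPart_le_pow_smul (n : ℕ) : backwardPart g U ≤ g ^ n • U := fun x hx => by
  rw [← zpow_natCast, mem_zpow_smul_iff]
  exact hx _ (by simp)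

theorem forwardPart_le_inv_smul : forwardPart g U ≤ g⁻¹ • forwardPart g U := fun x hx => by
  rw [Subgroup.mem_inv_pointwise_smul_iff]
  simpa using zpow_smul_mem_forwardPart hx (n := 1) (by omega)

theorem TidyAbove.relIndex_pow_smul (h : TidyAbove g U) (n : ℕ) :
    (g ^ n • U).relIndex (forwardPart g U) = (g ^ n • U).relIndex U :=
  relIndex_eq_of_subset_mul (forwardPart_le g U) (h.subset_forward_mul_backward.trans
    (Set.mul_subset_mul_left (backwardPart_le_pow_smul n)))

/-- With `M` the forward part of `U`, both sides are the index of `M ∩ gⁿ U` in `g⁻¹ M`. -/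
theorem TidyAbove.relIndex_recurrence (h : TidyAbove g U) (n : ℕ) :
    (forwardPart g U).relIndex (g ^ n • U ⊓ g⁻¹ • forwardPart g U) *
        (g ^ (n + 1) • U).relIndex U =
      (forwardPart g U).relIndex (g⁻¹ • forwardPart g U) * (g ^ n • U).relIndex U := by
  have h1 : (g ^ (n + 1) • U).relIndex U = (g ^ n • U).relIndex (g⁻¹ • forwardPart g U) := by
    rw [← h.relIndex_pow_smul, ← Subgroup.relIndex_pointwise_smul g⁻¹, smul_smul, pow_succ',
      inv_mul_cancel_left]
  rw [h1, Subgroup.relIndex_inf_mul_relIndex, inf_comm, ← Subgroup.relIndex_inf_mul_relIndex,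
    inf_of_le_left forwardPart_le_inv_smul, h.relIndex_pow_smul, mul_comm]

/-- Modulo the forward part `M`, the elements of `gⁿ U` are represented by those of `gⁿ P`, where
`P` is the backward part. -/
theorem TidyAbove.pow_smul_inf_subset (h : TidyAbove g U) (n : ℕ) :
    ((g ^ n • U ⊓ g⁻¹ • forwardPart g U : Subgroup X) : Set X) ⊆
      ((g ^ n • backwardPart g U ⊓ g⁻¹ • forwardPart g U : Subgroup X) : Set X) *
        (forwardPart g U : Set X) := by
  rintro x ⟨hxU, hxM⟩
  obtain ⟨p, hp, m, hm, hpm⟩ := h (Subgroup.mem_pointwise_smul_iff_inv_smul_mem.1 hxU)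
  have hx : x = g ^ n • p * g ^ n • m := by
    rw [← smul_mul', ← inv_smul_eq_iff]; exact hpm.symm
  have hm' : g ^ n • m ∈ forwardPart g U := by
    simpa using zpow_smul_mem_forwardPart hm (n := n) (by omega)
  refine ⟨g ^ n • p, ⟨Subgroup.smul_mem_pointwise_smul _ _ _ hp, ?_⟩, g ^ n • m, hm', hx.symm⟩
  have : g ^ n • p = x * (g ^ n • m)⁻¹ := by rw [hx, mul_inv_cancel_right]
  rw [this]
  exact Subgroup.mul_mem _ hxM (Subgroup.inv_mem _ (forwardPart_le_inv_smul hm'))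

theorem pow_smul_backwardPart_mono {a b : ℕ} (hab : a ≤ b) :
    g ^ a • backwardPart g U ≤ g ^ b • backwardPart g U := fun x hx => by
  rw [← zpow_natCast, mem_zpow_smul_iff] at *
  have := zpow_smul_mem_backwardPart hx (n := a - b) (by omega)
  rw [smul_smul, ← zpow_add] at this
  convert this using 3
  omega

variable [TopologicalSpace X] [IsTopologicalGroup X] [ContinuousConstSMul Γ X]

theorem relIndex_forwardPart_ne_zero (hUc : IsCompact (U : Set X)) (hUo : IsOpen (U : Set X)) :
    (forwardPart g U).relIndex (g⁻¹ • forwardPart g U) ≠ 0 := by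
  have heq : forwardPart g U = U ⊓ g⁻¹ • forwardPart g U := by
    refine le_antisymm (le_inf (forwardPart_le g U) forwardPart_le_inv_smul) ?_
    rintro x ⟨hx, hx'⟩ j hj
    replace hx' := Subgroup.mem_inv_pointwise_smul_iff.1 hx'
    rcases eq_or_lt_of_le (show (0 : ℤ) ≤ j from hj) with rfl | hj'
    · simpa using hx
    · have := hx' (j - 1) (by simp only [Set.mem_Ici]; omega)
      rwa [smul_smul, ← zpow_add_one, sub_add_cancel] at this
  have hMc : IsCompact (forwardPart g U : Set X) :=
    isCompact_window hUc (U.isClosed_of_isOpen hUo) (by simp)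
  have h0 := relIndex_ne_zero_of_isOpen_of_isCompact hUo (isCompact_smul_subgroup g⁻¹ hMc)
  rwa [← Subgroup.inf_relIndex_right, ← heq] at h0

/-- The index of `U ∩ gⁿ U` in `U` is eventually geometric in `n` with an integral ratio `s`, and
`s` relates the index of the forward part `M` in `g⁻¹ M` to the number of cosets of `M` in `g⁻¹ M`
that meet a high translate `gᴺ P` of the backward part. -/
theorem TidyAbove.exists_hasScale_and_relIndex_eq (h : TidyAbove g U)
    (hUc : IsCompact (U : Set X)) (hUo : IsOpen (U : Set X)) :
    ∃ N s, HasScale X g s ∧ (forwardPart g U).relIndex (g⁻¹ • forwardPart g U) =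
      (forwardPart g U).relIndex (g ^ N • backwardPart g U ⊓ g⁻¹ • forwardPart g U) * s := by
  have ht := relIndex_forwardPart_ne_zero (g := g) hUc hUo
  have hc : ∀ n, (forwardPart g U).relIndex (g ^ n • backwardPart g U ⊓ g⁻¹ • forwardPart g U) =
      (forwardPart g U).relIndex (g ^ n • U ⊓ g⁻¹ • forwardPart g U) := fun n =>
    relIndex_eq_of_subset_mul (inf_le_inf_right _
      (Subgroup.pointwise_smul_le_pointwise_smul_iff.2 (backwardPart_le g U)))
      (h.pow_smul_inf_subset n)
  have hle : ∀ {K : Subgroup X}, K ≤ g⁻¹ • forwardPart g U →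
      (forwardPart g U).relIndex K ≠ 0 := fun hK h0 =>
    ht (Subgroup.relIndex_eq_zero_of_le_right hK h0)
  have hd : ∀ n : ℕ, (g ^ n • U).relIndex U ≠ 0 := fun n => relIndex_smul_self_ne_zero _ hUc hUo
  obtain ⟨N, s, hN, hs⟩ := exists_eventually_geometric
    (c := fun n => (forwardPart g U).relIndex
      (g ^ n • backwardPart g U ⊓ g⁻¹ • forwardPart g U))
    (d := fun n => (g ^ n • U).relIndex U) hd
    (fun a b hab => Subgroup.relIndex_le_of_le_right
      (inf_le_inf_right _ (pow_smul_backwardPart_mono hab)) (hle inf_le_right))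
    (hle inf_le_right) (fun n => Subgroup.relIndex_le_of_le_right inf_le_right ht)
    (fun n => by simp only [hc]; exact h.relIndex_recurrence n)
  exact ⟨N, s, hasScale_of_compact_open hUc hUo
    (exists_comparison_of_eventually_geometric hd hs), hN⟩

/-- If the scale is `1`, every coset of the forward part `M` in `g⁻¹ M` meets a fixed translate of
the backward part; by iteration the same translate works for all `g⁻ᵐ M`. -/
theorem TidyAbove.exists_forall_mem_mul (h : TidyAbove g U) (hUc : IsCompact (U : Set X))
    (hUo : IsOpen (U : Set X)) (hs : HasScale X g 1) :
    ∃ N : ℕ, ∀ (m : ℕ) (x : X), g ^ m • x ∈ forwardPart g U →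
      x ∈ ((g ^ N • backwardPart g U : Subgroup X) : Set X) * (forwardPart g U : Set X) := by
  obtain ⟨N, s, hs', ht⟩ := h.exists_hasScale_and_relIndex_eq hUc hUo
  obtain rfl := hs.eq hUc hUo hs'
  rw [mul_one] at ht
  have hsub := subset_mul_of_relIndex_eq inf_le_right ht.symm
    (relIndex_forwardPart_ne_zero hUc hUo)
  refine ⟨N, fun m => ?_⟩
  induction m with
  | zero => exact fun x hx => ⟨1, one_mem _, x, by simpa using hx, by simp⟩
  | succ m ih =>
    intro x hx
    obtain ⟨p, hp, y, hy, hpy⟩ := ih (g • x) (by rwa [smul_smul, ← pow_succ])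
    obtain ⟨q, hq, z, hz, hqz⟩ := hsub (Subgroup.mem_inv_pointwise_smul_iff.2
      (show g • (g⁻¹ • y) ∈ forwardPart g U by simpa using hy))
    have hp' : g⁻¹ • p ∈ g ^ N • backwardPart g U := by
      rw [Subgroup.mem_pointwise_smul_iff_inv_smul_mem]
      have := zpow_smul_mem_backwardPart (Subgroup.mem_pointwise_smul_iff_inv_smul_mem.1 hp)
        (n := -1) (by omega)
      rwa [zpow_neg_one, smul_smul, ← mul_inv_rev, ← pow_succ, pow_succ', mul_inv_rev,
        ← smul_smul] at this
    refine ⟨g⁻¹ • p * q, mul_mem hp' hq.1, z, hz, ?_⟩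
    change p * y = g • x at hpy
    change q * z = g⁻¹ • y at hqz
    change g⁻¹ • p * q * z = x
    rw [mul_assoc, hqz, ← smul_mul', hpy, inv_smul_smul]

theorem exists_hasScale [LocallyCompactSpace X] [TotallyDisconnectedSpace X] (g : Γ) :
    ∃ s, HasScale X g s := by
  obtain ⟨V, hVc, hVo, -⟩ := exists_compact_open_subgroup_subset (X := X) Filter.univ_mem
  obtain ⟨U, -, hUc, hUo, h⟩ := exists_tidyAbove_le g hVc hVo
  obtain ⟨-, s, hs, -⟩ := h.exists_hasScale_and_relIndex_eq hUc hUo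
  exact ⟨s, hs⟩

end Growth

/-! ### Invariant compact open subgroups -/

section Invariant

variable {Γ X : Type*} [Group Γ] [Group X] [MulDistribMulAction Γ X] {g : Γ} {U : Subgroup X}

/-- The elements whose forward orbit under `g` eventually stays in `U`. -/
def eventuallyForward (g : Γ) (U : Subgroup X) : Subgroup X where
  carrier := {x | ∃ m : ℕ, g ^ m • x ∈ forwardPart g U}
  one_mem' := ⟨0, by simp⟩
  mul_mem' := by
    rintro a b ⟨m, hm⟩ ⟨n, hn⟩
    refine ⟨m + n, ?_⟩
    rw [smul_mul']
    refine mul_mem ?_ ?_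
    · have := zpow_smul_mem_forwardPart hm (n := n) (by omega)
      rwa [zpow_natCast, smul_smul, ← pow_add, add_comm] at this
    · have := zpow_smul_mem_forwardPart hn (n := m) (by omega)
      rwa [zpow_natCast, smul_smul, ← pow_add] at this
  inv_mem' := by
    rintro a ⟨m, hm⟩
    exact ⟨m, by rw [smul_inv']; exact inv_mem hm⟩

theorem mem_eventuallyForward {x : X} :
    x ∈ eventuallyForward g U ↔ ∃ m : ℕ, g ^ m • x ∈ forwardPart g U := Iff.rfl

theorem forwardPart_le_eventuallyForward : forwardPart g U ≤ eventuallyForward g U :=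
  fun x hx => ⟨0, by simpa using hx⟩

theorem zpow_smul_mem_eventuallyForward {x : X} (hx : x ∈ eventuallyForward g U) (n : ℤ) :
    g ^ n • x ∈ eventuallyForward g U := by
  obtain ⟨m, hm⟩ := hx
  refine ⟨m + n.natAbs, ?_⟩
  have := zpow_smul_mem_forwardPart hm (n := n.natAbs + n) (by omega)
  rw [← zpow_natCast, smul_smul, ← zpow_add] at this ⊢
  convert this using 3
  push_cast
  ring

theorem smul_eventuallyForward : g • eventuallyForward g U = eventuallyForward g U := by
  ext x
  rw [Subgroup.mem_pointwise_smul_iff_inv_smul_mem]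
  refine ⟨fun h => ?_, fun h => by simpa using zpow_smul_mem_eventuallyForward h (-1)⟩
  simpa using zpow_smul_mem_eventuallyForward h 1

theorem mem_eventuallyForward_inv {x : X} :
    x ∈ eventuallyForward g⁻¹ U ↔ ∃ m : ℕ, x ∈ g ^ m • backwardPart g U := by
  rw [mem_eventuallyForward]
  simp only [forwardPart_inv, inv_pow, Subgroup.mem_pointwise_smul_iff_inv_smul_mem]

theorem smul_eventuallyForward_inv : g • eventuallyForward g⁻¹ U = eventuallyForward g⁻¹ U := by
  rw [smul_eq_iff_eq_inv_smul, smul_eventuallyForward]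

variable [TopologicalSpace X] [IsTopologicalGroup X] [ContinuousConstSMul Γ X]

/-- With `M` and `P` the forward and backward parts of `U`, the elements of `⋃ g⁻ᵐ M` can be moved
past those of `⋃ gᵐ P` at the cost of an element of `M`. -/
theorem TidyAbove.mul_mem_eventuallyForward_inv_mul (h : TidyAbove g U)
    (hUc : IsCompact (U : Set X)) (hUo : IsOpen (U : Set X)) (hs : HasScale X g 1) {x y : X}
    (hx : x ∈ eventuallyForward g U) (hy : y ∈ eventuallyForward g⁻¹ U) :
    x * y ∈ (eventuallyForward g⁻¹ U : Set X) * (forwardPart g U : Set X) := by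
  obtain ⟨N, hN⟩ := h.exists_forall_mem_mul hUc hUo hs
  obtain ⟨j, hj⟩ := mem_eventuallyForward_inv.1 hy
  rw [Subgroup.mem_pointwise_smul_iff_inv_smul_mem] at hj
  obtain ⟨k, hk⟩ := zpow_smul_mem_eventuallyForward hx (-j)
  obtain ⟨q, hq, m, hm, hqm⟩ := hN k _ hk
  obtain ⟨p, hp, m', hm', hpm⟩ := h (U.mul_mem (forwardPart_le g U hm) (backwardPart_le g U hj))
  have hqp : q * p ∈ g ^ N • backwardPart g U := by
    refine mul_mem hq ?_
    simpa using pow_smul_backwardPart_mono (Nat.zero_le N) (show p ∈ g ^ 0 • backwardPart g U by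
      simpa using hp)
  have hF := zpow_smul_mem_eventuallyForward (mem_eventuallyForward_inv.2 ⟨N, hqp⟩) (-j)
  refine ⟨g ^ j • (q * p), by simpa using hF, g ^ j • m',
    by simpa using zpow_smul_mem_forwardPart hm' (n := j) (by omega), ?_⟩
  change q * m = g ^ (-(j : ℤ)) • x at hqm
  change p * m' = m * (g ^ j)⁻¹ • y at hpm
  change g ^ j • (q * p) * g ^ j • m' = x * y
  rw [← smul_mul', mul_assoc, hpm, ← mul_assoc, hqm, zpow_neg, zpow_natCast, ← smul_mul',
    smul_inv_smul]

/-- If both `g` and `g⁻¹` have scale `1` then `g` leaves some compact open subgroup invariant. With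
`M` and `P` the forward and backward parts of a subgroup that is tidy above, the group generated
by all `g⁻ᵐ M` and `gᵐ P` is `(⋃ gᵐ P) M`, and `⋃ gᵐ P` lies in a compact set. -/
theorem exists_compact_open_smul_eq [LocallyCompactSpace X] [TotallyDisconnectedSpace X]
    (hs : HasScale X g 1) (hs' : HasScale X g⁻¹ 1) :
    ∃ K : Subgroup X, IsCompact (K : Set X) ∧ IsOpen (K : Set X) ∧ g • K = K := by
  obtain ⟨V, hVc, hVo, -⟩ := exists_compact_open_subgroup_subset (X := X) Filter.univ_mem
  obtain ⟨U, -, hUc, hUo, h⟩ := exists_tidyAbove_le g hVc hVo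
  have hUcl := U.isClosed_of_isOpen hUo
  set E := eventuallyForward g U
  set F := eventuallyForward g⁻¹ U
  set M := forwardPart g U
  have hMc : IsCompact (M : Set X) := isCompact_window hUc hUcl (by simp)
  have hUEF : U ≤ E ⊔ F := by
    intro x hx
    obtain ⟨p, hp, m, hm, rfl⟩ := h hx
    exact mul_mem (Subgroup.mem_sup_right (mem_eventuallyForward_inv.2 ⟨0, by simpa using hp⟩))
      (Subgroup.mem_sup_left (forwardPart_le_eventuallyForward hm))
  have hopen : IsOpen ((E ⊔ F : Subgroup X) : Set X) := Subgroup.isOpen_mono hUEF hUo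
  have hE : ∀ a ∈ E, ∀ y ∈ (F : Set X) * (M : Set X), a * y ∈ (F : Set X) * (M : Set X) := by
    rintro a ha _ ⟨f, hf, m, hm, rfl⟩
    obtain ⟨f', hf', m', hm', hfm⟩ := h.mul_mem_eventuallyForward_inv_mul hUc hUo hs ha hf
    exact ⟨f', hf', m' * m, mul_mem hm' hm, by
      change f' * m' = a * f at hfm
      change f' * (m' * m) = a * (f * m)
      rw [← mul_assoc, hfm, mul_assoc]⟩
  have hF : ∀ a ∈ F, ∀ y ∈ (F : Set X) * (M : Set X), a * y ∈ (F : Set X) * (M : Set X) := by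
    rintro a ha _ ⟨f, hf, m, hm, rfl⟩
    exact ⟨a * f, mul_mem ha hf, m, hm, mul_assoc _ _ _⟩
  have hsub : ((E ⊔ F : Subgroup X) : Set X) ⊆ (F : Set X) * (M : Set X) := by
    intro x hx
    rw [SetLike.mem_coe, Subgroup.sup_eq_closure] at hx
    induction hx using Subgroup.closure_induction_left with
    | one => exact ⟨1, F.one_mem, 1, M.one_mem, one_mul _⟩
    | mul_left a ha y _ ih => exact ha.elim (hE a · y ih) (hF a · y ih)
    | inv_mul_cancel a ha y _ ih =>
      exact ha.elim (fun ha => hE _ (E.inv_mem ha) y ih) (fun ha => hF _ (F.inv_mem ha) y ih)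
  obtain ⟨N, hN⟩ := h.inv.exists_forall_mem_mul hUc hUo hs'
  have hcpt : IsCompact (((g⁻¹ ^ N • backwardPart g⁻¹ U : Subgroup X) : Set X) *
      (forwardPart g⁻¹ U : Set X) * (M : Set X)) :=
    ((isCompact_smul_subgroup _ (isCompact_window hUc hUcl (by simp))).mul
      (isCompact_window hUc hUcl (by simp))).mul hMc
  refine ⟨E ⊔ F, hcpt.of_isClosed_subset (Subgroup.isClosed_of_isOpen _ hopen)
    (hsub.trans (Set.mul_subset_mul_right ?_)), hopen, ?_⟩
  · rintro x ⟨m, hm⟩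
    exact hN m x hm
  · rw [Subgroup.smul_sup, smul_eventuallyForward, smul_eventuallyForward_inv]

end Invariant

/-! ### Local constancy of the scale -/

section LocallyConstant

theorem toConjAct_zpow_smul {G : Type*} [Group G] (g v : G) (n : ℤ) :
    ConjAct.toConjAct g ^ n • v = g ^ n * v * (g ^ n)⁻¹ := by
  rw [← map_zpow, ConjAct.toConjAct_smul]

/-- If `V` is tidy above for conjugation by `g` then `V gᵃ V gᵇ V = V gᵃ⁺ᵇ V`. -/
theorem TidyAbove.mul_mem_doubleCoset {G : Type*} [Group G] {g : G} {V : Subgroup G}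
    (h : TidyAbove (ConjAct.toConjAct g) V) {a b : ℕ} {x y : G}
    (hx : x ∈ DoubleCoset.doubleCoset (g ^ a) V V) (hy : y ∈ DoubleCoset.doubleCoset (g ^ b) V V) :
    x * y ∈ DoubleCoset.doubleCoset (g ^ (a + b)) V V := by
  rw [DoubleCoset.mem_doubleCoset] at *
  obtain ⟨v₁, h₁, v₂, h₂, rfl⟩ := hx
  obtain ⟨v₃, h₃, v₄, h₄, rfl⟩ := hy
  obtain ⟨m, hm, p, hp, hmp⟩ := h.subset_forward_mul_backward (V.mul_mem h₂ h₃)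
  have hm' := zpow_smul_mem_forwardPart hm (n := a) (by omega)
  have hp' := zpow_smul_mem_backwardPart hp (n := -b) (by omega)
  rw [toConjAct_zpow_smul] at hm' hp'
  refine ⟨_, V.mul_mem h₁ (forwardPart_le _ _ hm'), _, V.mul_mem (backwardPart_le _ _ hp') h₄, ?_⟩
  change m * p = v₂ * v₃ at hmp
  calc v₁ * g ^ a * v₂ * (v₃ * g ^ b * v₄) = v₁ * g ^ a * (v₂ * v₃) * g ^ b * v₄ := by group
    _ = _ := by
      rw [← hmp, pow_add, zpow_neg, zpow_natCast, zpow_natCast]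
      group

theorem TidyAbove.pow_mem_doubleCoset {G : Type*} [Group G] {g : G} {V : Subgroup G}
    (h : TidyAbove (ConjAct.toConjAct g) V) {a : ℕ} {x : G}
    (hx : x ∈ DoubleCoset.doubleCoset (g ^ a) V V) (n : ℕ) :
    x ^ n ∈ DoubleCoset.doubleCoset (g ^ (a * n)) V V := by
  induction n with
  | zero => exact DoubleCoset.mem_doubleCoset.2 ⟨1, V.one_mem, 1, V.one_mem, by simp⟩
  | succ n ih => rw [pow_succ, Nat.mul_succ]; exact h.mul_mem_doubleCoset ih hx

theorem isOpen_stabilizer_of_compact_open {G X : Type*} [Group G]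
    [TopologicalSpace G] [IsTopologicalGroup G] [Group X] [TopologicalSpace X]
    [MulDistribMulAction G X] [ContinuousSMul G X] {U : Subgroup X} (hUc : IsCompact (U : Set X))
    (hUo : IsOpen (U : Set X)) : IsOpen (MulAction.stabilizer G U : Set G) := by
  have hnhds : ∀ᶠ g : G in 𝓝 1, g • U ≤ U := by
    obtain ⟨A, B, hA, -, h1A, hUB, hAB⟩ := generalized_tube_lemma
      (isCompact_singleton (x := (1 : G))) hUc (hUo.preimage (continuous_smul (M := G) (X := X))) (by
        rintro ⟨g, x⟩ ⟨hg, hx⟩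
        obtain rfl : g = 1 := hg
        simpa using hx)
    filter_upwards [hA.mem_nhds (h1A rfl)] with g hg
    rintro _ ⟨x, hx, rfl⟩
    exact hAB (Set.mk_mem_prod hg (hUB hx))
  refine Subgroup.isOpen_of_mem_nhds _ (g := 1) ?_
  filter_upwards [hnhds, (continuous_inv.tendsto' (1 : G) 1 inv_one).eventually hnhds]
    with g hg hg'
  exact MulAction.mem_stabilizer_iff.2 (le_antisymm hg (Subgroup.subset_pointwise_smul_iff.2 hg'))

variable {G X : Type*} [Group G] [TopologicalSpace G] [IsTopologicalGroup G]
  [Group X] [TopologicalSpace X] [IsTopologicalGroup X] [MulDistribMulAction G X]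
  [ContinuousSMul G X]
  [LocallyCompactSpace G] [TotallyDisconnectedSpace G]
  [LocallyCompactSpace X] [TotallyDisconnectedSpace X]

/-- The scale of all powers of `g` is locally constant, uniformly over the powers: for a compact
open subgroup `V` of `G` which is tidy above for conjugation by `g` and leaves some compact open
subgroup `U` of `X` invariant, elements `x ∈ V gᵃ V` satisfy `xⁿ ∈ V gᵃⁿ V`, so the indices
of `U ∩ xⁿ U` and `U ∩ gᵃⁿ U` in `U` agree. -/
theorem exists_open_subgroup_hasScale_doubleCoset_iff (g : G) :
    ∃ V : Subgroup G, IsOpen (V : Set G) ∧ ∀ (a s : ℕ) (x : G), x ∈ DoubleCoset.doubleCoset (g ^ a) V V →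
      (HasScale X x s ↔ HasScale X (g ^ a) s) := by
  obtain ⟨U, hUc, hUo, -⟩ := exists_compact_open_subgroup_subset (X := X) Filter.univ_mem
  obtain ⟨W, hWc, hWo, hW⟩ := exists_compact_open_subgroup_subset
    ((isOpen_stabilizer_of_compact_open (G := G) hUc hUo).mem_nhds (one_mem _))
  obtain ⟨V, hVW, hVc, hVo, hV⟩ := exists_tidyAbove_le (ConjAct.toConjAct g) hWc hWo
  refine ⟨V, hVo, fun a s x hx => ?_⟩
  have hstab : ∀ v ∈ V, v • U = U := fun v hv => MulAction.mem_stabilizer_iff.1 (hW (hVW hv))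
  have key : ∀ n : ℕ, (x ^ n • U).relIndex U = ((g ^ a) ^ n • U).relIndex U := by
    intro n
    obtain ⟨v, hv, w, hw, hvw⟩ := DoubleCoset.mem_doubleCoset.1 (hV.pow_mem_doubleCoset hx n)
    rw [hvw, mul_smul, mul_smul, hstab w hw, pow_mul]
    conv_lhs => rw [← hstab v hv, Subgroup.relIndex_pointwise_smul, hstab v hv]
  constructor <;> intro hs <;> refine hasScale_of_compact_open hUc hUo ?_
  · simpa only [key] using hs U hUc hUo
  · simpa only [key] using hs U hUc hUo

/-- If the `k`-th powers are dense in `H` then `H` has scale `1`: by local constancy, the scale of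
each element of `H` is the `k`-th power of the scale of another element, and descent applies. -/
theorem hasScale_one_of_powerMapDense {H : Subgroup G} {k : ℕ} (hk : 1 < k)
    (hdense : PowerMapDense k H) {h : G} (hh : h ∈ H) : HasScale X h 1 := by
  suffices ∀ s, ∀ h ∈ H, HasScale X h s → s = 1 by
    obtain ⟨s, hs⟩ := exists_hasScale (X := X) h
    exact this s h hh hs ▸ hs
  intro s
  induction s using Nat.strong_induction_on with
  | _ s ih =>
    intro h hh hs
    obtain ⟨V, hVo, hV⟩ := exists_open_subgroup_hasScale_doubleCoset_iff (X := X) h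
    have hopen : IsOpen {y : H | (y : G) ∈ DoubleCoset.doubleCoset (h ^ 1) V V} := by
      refine IsOpen.preimage continuous_subtype_val ?_
      rw [DoubleCoset.doubleCoset]
      exact hVo.mul_left
    obtain ⟨y, hy⟩ := hdense.exists_mem_open hopen
      ⟨⟨h, hh⟩, DoubleCoset.mem_doubleCoset.2 ⟨1, V.one_mem, 1, V.one_mem, by simp⟩⟩
    obtain ⟨r, hr⟩ := exists_hasScale (X := X) (y : G)
    have hsr : s = r ^ k := hs.unique (by
      have := (hV 1 (r ^ k) _ hy).1 (by simpa using hr.pow k)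
      rwa [pow_one] at this)
    -- The scale is nonzero, since it is comparable to nonzero indices.
    have hr0 : r ≠ 0 := by
      rintro rfl
      obtain ⟨U, hUc, hUo, -⟩ := exists_compact_open_subgroup_subset (X := X) Filter.univ_mem
      obtain ⟨C, hC⟩ := hr U hUc hUo
      have := (hC 1).2
      exact relIndex_smul_self_ne_zero ((y : G) ^ 1) hUc hUo (by simpa using this)
    by_cases hr1 : r = 1
    · rw [hsr, hr1, one_pow]
    · exact absurd (ih r (hsr ▸ lt_self_pow₀ (by omega) hk) y y.2 hr) hr1

end LocallyConstant

/-! ### Recurrence modulo cocompact and finite covolume subgroups -/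

section Recurrence

variable {G : Type*} [Group G] [TopologicalSpace G] [IsTopologicalGroup G] {H : Subgroup G}

/-- Finitely many sets `V y H` cover `G`, so two powers of `g` lie in the same one. -/
theorem IsCocompactSubgroup.exists_conj_mem_doubleCoset (hH : IsCocompactSubgroup H) (g : G)
    {V : Subgroup G} (hV : IsOpen (V : Set G)) :
    ∃ n ≠ 0, ∃ y, ∃ h ∈ H, y * h * y⁻¹ ∈ DoubleCoset.doubleCoset (g ^ n) V V := by
  have : CompactSpace (G ⧸ H) := hH
  let S : G → Set (G ⧸ H) := fun y => (fun v : G => (v : G ⧸ H)) '' ((V : Set G) * {y})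
  have hS : ∀ y, IsOpen (S y) := fun y => QuotientGroup.isOpenMap_coe _ hV.mul_right
  obtain ⟨F, hF⟩ := isCompact_univ.elim_finite_subcover S hS (by
    intro q _
    obtain ⟨y, rfl⟩ := QuotientGroup.mk_surjective q
    exact Set.mem_iUnion.2 ⟨y, y, ⟨1, V.one_mem, y, rfl, one_mul y⟩, rfl⟩)
  have hmem : ∀ n : ℕ, ∃ y : F, ((g ^ n : G) : G ⧸ H) ∈ S y := fun n => by
    obtain ⟨y, hy, hn⟩ := Set.mem_iUnion₂.1 (hF (Set.mem_univ ((g ^ n : G) : G ⧸ H)))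
    exact ⟨⟨y, hy⟩, hn⟩
  choose f hf using hmem
  have hrep : ∀ n : ℕ, ∃ v ∈ V, ∃ h ∈ H, g ^ n = v * f n * h := fun n => by
    obtain ⟨_, ⟨v, hv, y, hy, rfl⟩, hn⟩ := hf n
    obtain rfl : y = f n := hy
    exact ⟨v, hv, _, QuotientGroup.eq.1 hn, by group⟩
  obtain ⟨i, j, hij, hfij⟩ : ∃ i j, i < j ∧ f i = f j := by
    obtain ⟨i, j, hne, h⟩ := Finite.exists_ne_map_eq_of_infinite f
    rcases lt_or_gt_of_ne hne with hlt | hlt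
    exacts [⟨i, j, hlt, h⟩, ⟨j, i, hlt, h.symm⟩]
  obtain ⟨v, hv, h, hh, hi⟩ := hrep i
  obtain ⟨v', hv', h', hh', hj⟩ := hrep j
  refine ⟨j - i, by omega, f j, h' * h⁻¹, H.mul_mem hh' (H.inv_mem hh),
    DoubleCoset.mem_doubleCoset.2 ⟨v'⁻¹, V.inv_mem hv', v, hv, ?_⟩⟩
  rw [pow_sub g hij.le, hi, hj, hfij]
  group

/-- Poincaré recurrence for the image of `V` in `G ⧸ H`, which has positive measure because its
translates cover the compact subsets of `G ⧸ H`. -/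
theorem HasFiniteCovolume.exists_conj_mem_doubleCoset (hH : HasFiniteCovolume H) (g : G)
    {V : Subgroup G} (hV : IsOpen (V : Set G)) :
    ∃ n ≠ 0, ∃ y, ∃ h ∈ H, y * h * y⁻¹ ∈ DoubleCoset.doubleCoset (g ^ n) V V := by
  let _ : MeasurableSpace (G ⧸ H) := borel (G ⧸ H)
  have : BorelSpace (G ⧸ H) := ⟨rfl⟩
  obtain ⟨μ, hμ, hfin, hreg, hinv⟩ := hH
  set A : Set (G ⧸ H) := (fun v : G => (v : G ⧸ H)) '' (V : Set G)
  have hA : IsOpen A := QuotientGroup.isOpenMap_coe _ hV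
  have hA0 : μ A ≠ 0 := by
    intro h0
    obtain ⟨K, -, hK, hK0⟩ := isOpen_univ.exists_lt_isCompact
      (pos_iff_ne_zero.2 (MeasureTheory.Measure.measure_univ_ne_zero.2 hμ))
    refine hK0.ne' (hK.measure_zero_of_nhdsWithin fun q _ => ?_)
    obtain ⟨y, rfl⟩ := QuotientGroup.mk_surjective q
    refine ⟨y • A, mem_nhdsWithin_of_mem_nhds ((hA.smul y).mem_nhds ?_), ?_⟩
    · exact ⟨((1 : G) : G ⧸ H), ⟨1, V.one_mem, rfl⟩, by
        change ((y * 1 : G) : G ⧸ H) = y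
        rw [mul_one]⟩
    · rw [hinv y A hA.measurableSet, h0]
  have hpres : MeasureTheory.MeasurePreserving (fun q : G ⧸ H => g • q) μ μ := by
    refine ⟨(continuous_const_smul g).measurable, ?_⟩
    ext B hB
    rw [MeasureTheory.Measure.map_apply (continuous_const_smul g).measurable hB,
      Set.preimage_smul, hinv g⁻¹ B hB]
  obtain ⟨_, ⟨v, hv, rfl⟩, n, hn, v', hv', hvv'⟩ :=
    hpres.conservative.exists_mem_iterate_mem hA.measurableSet.nullMeasurableSet hA0
  rw [smul_iterate] at hvv'
  have hmem : v'⁻¹ * (g ^ n * v) ∈ H := QuotientGroup.eq.1 hvv'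
  exact ⟨n, hn, 1, _, hmem,
    DoubleCoset.mem_doubleCoset.2 ⟨v'⁻¹, V.inv_mem hv', v, hv, by group⟩⟩

end Recurrence

/-! ### Scale one on the whole group -/

/-- Some power `gⁿ` lies in `V (y h y⁻¹) V` with `h ∈ H`, hence has scale `1`. -/
theorem hasScale_one_of_recurrence {G X : Type*}
    [Group G] [TopologicalSpace G] [IsTopologicalGroup G]
    [LocallyCompactSpace G] [TotallyDisconnectedSpace G]
    [Group X] [TopologicalSpace X] [IsTopologicalGroup X]
    [LocallyCompactSpace X] [TotallyDisconnectedSpace X]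
    [MulDistribMulAction G X] [ContinuousSMul G X]
    {H : Subgroup G} (hH : IsCocompactSubgroup H ∨ HasFiniteCovolume H)
    (hscale : ∀ h ∈ H, HasScale X h 1) (g : G) : HasScale X g 1 := by
  obtain ⟨V, hVo, hV⟩ := exists_open_subgroup_hasScale_doubleCoset_iff (X := X) g
  obtain ⟨n, hn, y, h, hh, hy⟩ : ∃ n ≠ 0, ∃ y, ∃ h ∈ H,
      y * h * y⁻¹ ∈ DoubleCoset.doubleCoset (g ^ n) V V :=
    hH.elim (·.exists_conj_mem_doubleCoset g hVo) (·.exists_conj_mem_doubleCoset g hVo)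
  obtain ⟨s, hs⟩ := exists_hasScale (X := X) g
  have hsn : s ^ n = 1 := (hs.pow n).unique ((hV n 1 _ hy).1 ((hscale h hh).conj y))
  rwa [(Nat.pow_eq_one.1 hsn).resolve_right hn] at hs

theorem proposition5p1
    {G X : Type*}
    [Group G] [TopologicalSpace G] [IsTopologicalGroup G]
    [LocallyCompactSpace G] [TotallyDisconnectedSpace G]
    [Group X] [TopologicalSpace X] [IsTopologicalGroup X]
    [LocallyCompactSpace X] [TotallyDisconnectedSpace X]
    [MulDistribMulAction G X] [ContinuousSMul G X]
    (H : Subgroup G) (hH : IsCocompactSubgroup H ∨ HasFiniteCovolume H)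
    (k : ℕ) (hk : 1 < k) (hdense : PowerMapDense k H) :
    ∀ g : G, ∃ U : Subgroup X,
      IsCompact (U : Set X) ∧ IsOpen (U : Set X) ∧ g • U = U := by
  intro g
  have hscale : ∀ g : G, HasScale X g 1 := hasScale_one_of_recurrence hH fun h hh =>
    hasScale_one_of_powerMapDense hk hdense hh
  exact exists_compact_open_smul_eq (hscale g) (hscale g⁻¹)
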